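/- **Theorem 1.1.** Let $c_1,\dots,c_s$ be distinct integers, let $S=\{x^2+c_1,\dots,x^2+c_s\}\subset\mathbb{Q}[x]$, and let $M_S$ be the semigroup generated by $S$ under composition, i.e. the set of all polynomials $\theta_1\circ\cdots\circ\theta_n$ with $n\ge 1$ and $\theta_1,\dots,\theta_n\in S$. Assume that at least two of the polynomials in $S$ are irreducible in $\mathbb{Q}[x]$. Then there exist an integer $N\ge 2$ and polynomials $\phi_i,\phi_j\in S$ such that, for every $F\in M_S$, the polynomial $$\phi_i^{N}\circ\phi_j\circ\phi_i\circ F$$ is irreducible in $\mathbb{Q}[x]$, where $\phi_i^{N}=\phi_i\circ\cdots\circ\phi_i$ denotes the $N$-fold iterate of $\phi_i$ under composition. -/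

import Mathlib

open Polynomial

/-- The set `S = {x² + c₁, …, x² + cₛ}`, viewed in `ℚ[x]`. -/
noncomputable def quadraticSet {s : ℕ} (c : Fin s → ℤ) : Set ℚ[X] :=
  Set.range fun i => (X : ℚ[X]) ^ 2 + C (c i : ℚ)

/-- The semigroup `M_S` generated by `S` under composition: all polynomials
`θ₁ ∘ ⋯ ∘ θₙ` with `n ≥ 1` and every `θᵢ` in `S`. -/
def compSemigroup (S : Set ℚ[X]) : Set ℚ[X] :=
  {f | ∃ l : List ℚ[X], l ≠ [] ∧ (∀ θ ∈ l, θ ∈ S) ∧ f = l.foldr Polynomial.comp X}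

/-- The `N`-th iterate of the polynomial `φ` under composition (the identity for `N = 0`). -/
noncomputable def polyIterate (φ : ℚ[X]) (N : ℕ) : ℚ[X] := φ.comp^[N] X

/-! By Capelli's lemma and a norm computation, a monic irreducible `f` of even degree stays
irreducible under `x ↦ x² + r` once `f r` is not a square (`irreducible_comp_X_sq_add_C`). Write φ,
ψ for `x² + c`, `x² + d`. It remains to see that `φ^N` takes non-square values at `d` and at every
`ψ (φ a)`, `a` an integer. For large even `N`, an orbit of φ either grows until its values fall
strictly between consecutive squares, or settles on a short cycle; it ends at a square only if it
starts at `±s²`, with `s²` periodic (`exists_squarePeriodic_of_isSquare_iterate`). Size estimates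
show that, for one of the two orders of the pair, these starting points are never hit
(`avoidsSquares_or`). -/

/-- The norm of `r - x` for the generator `x` of a power basis is the value at `r` of the minimal
polynomial of `x`. -/
theorem norm_algebraMap_sub_gen {K L : Type*} [Field K] [Field L] [Algebra K L]
    (pb : PowerBasis K L) (r : K) :
    Algebra.norm K (algebraMap K L r - pb.gen) = (minpoly K pb.gen).eval r := by
  rw [Algebra.norm_eq_matrix_det pb.basis, ← charpoly_leftMulMatrix pb, Matrix.eval_charpoly,
    map_sub, AlgHom.commutes]
  rfl

theorem irreducible_comp_X_sq_add_C {K : Type*} [Field K] {f : K[X]} (hm : f.Monic)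
    (hf : Irreducible f) (hd : Even f.natDegree) {r : K} (hr : ¬ IsSquare (f.eval r)) :
    Irreducible (f.comp (X ^ 2 + C r)) := by
  refine Polynomial.irreducible_comp hm (monic_X_pow_add_C r two_ne_zero) hf ?_
  intro E _ _ x hx
  have hint : IsIntegral K x := by
    by_contra h
    exact hf.ne_zero (hx ▸ minpoly.eq_zero h)
  have key : (X ^ 2 + C r : K[X]).map (algebraMap K (IntermediateField.adjoin K {x})) -
      C (IntermediateField.AdjoinSimple.gen K x) =
      X ^ 2 - C (IntermediateField.AdjoinSimple.gen K x - algebraMap K _ r) := by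
    simp only [Polynomial.map_add, Polynomial.map_pow, map_X, map_C, map_sub]
    ring
  rw [key]
  refine X_pow_sub_C_irreducible_of_prime Nat.prime_two fun b hb => hr ?_
  set pb := IntermediateField.adjoin.powerBasis hint with hpb
  have hgen : pb.gen = IntermediateField.AdjoinSimple.gen K x :=
    IntermediateField.adjoin.powerBasis_gen hint
  have hmin : minpoly K pb.gen = f := by rw [hgen, IntermediateField.minpoly_gen, hx]
  have hn := norm_algebraMap_sub_gen pb r
  have hneg : algebraMap K _ r - pb.gen = algebraMap K _ (-1) * b ^ 2 := by
    rw [hb, hgen, map_neg, map_one]; ring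
  have hfin : Module.finrank K (IntermediateField.adjoin K {x}) = f.natDegree := by
    rw [pb.finrank, ← pb.natDegree_minpoly, hmin]
  rw [hmin, hneg, map_mul, Algebra.norm_algebraMap, map_pow, hfin, hd.neg_one_pow, one_mul] at hn
  exact ⟨_, hn.symm.trans (sq _)⟩

/-! ### Squares in integer orbits of `x² + c` -/

/-- The map `x ↦ x² + c` on the integers. -/
def quadMap (c : ℤ) (x : ℤ) : ℤ := x ^ 2 + c

/-- The squares next to `y²` are `(|y| ± 1)²`, out of reach of a shift by `c`; the only collision is
`c = -1`, `|y| = 1`. -/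
theorem not_isSquare_quadMap {c y : ℤ} (h0 : c ≠ 0) (h1 : c ≠ -1) (hy : |c| ≤ |y|) :
    ¬ IsSquare (quadMap c y) := by
  rintro ⟨z, hz⟩
  rw [quadMap, ← sq_abs y, ← abs_mul_abs_self z] at hz
  generalize |y| = t at *
  have hz0 := abs_nonneg z
  generalize |z| = w at *
  rcases lt_or_gt_of_ne h0 with hc | hc
  · rw [abs_of_neg hc] at hy
    have a1 : w < t := by nlinarith
    have a2 : t - 1 < w := by
      by_contra h
      have : c ≤ -2 := by omega
      nlinarith [mul_self_le_mul_self hz0 (not_lt.1 h)]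
    omega
  · rw [abs_of_pos hc] at hy
    have a1 : t < w := by nlinarith
    have a2 : w < t + 1 := by nlinarith
    omega

theorem abs_le_abs_iterate_quadMap_zero {c : ℤ} (h0 : c ≠ 0) (h1 : c ≠ -1) (k : ℕ) :
    |c| ≤ |(quadMap c)^[k + 1] 0| := by
  induction k with
  | zero => simp [quadMap]
  | succ k ih =>
    rw [Function.iterate_succ_apply']
    generalize (quadMap c)^[k + 1] 0 = y at ih
    refine le_trans ?_ (le_abs_self _)
    rw [quadMap, ← sq_abs y]
    rcases lt_or_gt_of_ne h0 with hc | hc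
    · rw [abs_of_neg hc] at ih ⊢
      have : c ≤ -2 := by omega
      nlinarith
    · rw [abs_of_pos hc]
      nlinarith [sq_nonneg |y|]

theorem not_isSquare_iterate_quadMap_zero {c : ℤ} (h0 : c ≠ 0) (h1 : c ≠ -1) (k : ℕ) :
    ¬ IsSquare ((quadMap c)^[k + 2] 0) := by
  rw [Function.iterate_succ_apply']
  exact not_isSquare_quadMap h0 h1 (abs_le_abs_iterate_quadMap_zero h0 h1 k)

/-- A sufficient condition for the orbit of `y` under `x ↦ x² + c` to be strictly increasing. -/
def Escapes (c y : ℤ) : Prop := |y| + 1 ≤ quadMap c y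

theorem Escapes.quadMap {c y : ℤ} (h : Escapes c y) : Escapes c (quadMap c y) := by
  have hy := abs_nonneg y
  have hp : 0 ≤ _root_.quadMap c y := le_trans (by omega) h
  unfold Escapes at h ⊢
  rw [abs_of_nonneg hp]
  generalize hz : _root_.quadMap c y = z at *
  rw [_root_.quadMap, ← sq_abs y] at hz
  rw [_root_.quadMap]
  nlinarith

theorem Escapes.iterate {c y : ℤ} (h : Escapes c y) (k : ℕ) :
    Escapes c ((_root_.quadMap c)^[k] y) ∧ |y| + k ≤ |(_root_.quadMap c)^[k] y| := by
  induction k with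
  | zero => simpa using h
  | succ k ih =>
    rw [Function.iterate_succ_apply']
    refine ⟨ih.1.quadMap, ?_⟩
    have h1 := ih.1
    have h2 := ih.2
    unfold Escapes at h1
    have h3 := le_abs_self (_root_.quadMap c ((_root_.quadMap c)^[k] y))
    push_cast
    linarith

theorem Escapes.not_isSquare_iterate {c y : ℤ} (h0 : c ≠ 0) (h1 : c ≠ -1) {j : ℕ}
    (h : Escapes c ((_root_.quadMap c)^[j] y)) {N : ℕ} (hN : c.natAbs + j + 1 ≤ N) :
    ¬ IsSquare ((_root_.quadMap c)^[N] y) := by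
  obtain ⟨k, rfl⟩ := Nat.exists_eq_add_of_le hN
  have : c.natAbs + j + 1 + k = ((c.natAbs + k) + j) + 1 := by ring
  rw [this, Function.iterate_succ_apply', Function.iterate_add_apply]
  refine not_isSquare_quadMap h0 h1 ?_
  have h2 := (h.iterate (c.natAbs + k)).2
  have h3 := abs_nonneg ((_root_.quadMap c)^[j] y)
  push_cast at h2
  linarith

theorem escapes_of_pos {c : ℤ} (hc : 0 < c) (y : ℤ) : Escapes c y := by
  have : |y| ≤ |y| ^ 2 := by nlinarith [abs_nonneg y, sq_abs y, Int.le_self_sq |y|]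
  rw [sq_abs] at this
  unfold Escapes quadMap
  linarith

theorem exists_sq_sub_self_le_lt {m : ℤ} (hm : 2 ≤ m) :
    ∃ u : ℤ, 2 ≤ u ∧ u ^ 2 - u ≤ m ∧ m < u ^ 2 + u := by
  obtain ⟨n, rfl⟩ := Int.eq_ofNat_of_zero_le (by omega : 0 ≤ m)
  have h : ∃ v : ℕ, n < v ^ 2 + v := ⟨n + 1, by nlinarith⟩
  have hs := Nat.find_spec h
  have hmin := fun k => Nat.find_min (m := k) h
  generalize Nat.find h = v at *
  have hn : 2 ≤ n := by exact_mod_cast hm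
  have hv : 2 ≤ v := by
    by_contra hh
    interval_cases v <;> omega
  have h1 := hmin (v - 1) (by omega)
  obtain ⟨w, rfl⟩ := Nat.exists_eq_add_of_le' (by omega : 1 ≤ v)
  simp only [Nat.add_sub_cancel, not_lt] at h1
  refine ⟨(w + 1 : ℕ), by exact_mod_cast hv, ?_, by exact_mod_cast hs⟩
  zify at h1
  push_cast
  linarith

theorem escapes_of_lt_abs {m u y : ℤ} (hu : 2 ≤ u) (hm : m < u ^ 2 + u) (hy : u < |y|) :
    Escapes (-m) y := by
  unfold Escapes quadMap
  rw [← sq_abs y]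
  nlinarith

theorem quadMap_eq_of_abs_eq {m y t : ℤ} (h : |y| = t) : quadMap (-m) y = t ^ 2 - m := by
  rw [quadMap, ← sq_abs y, h]; ring

/-- Here `u` is `√m` rounded to an integer, and points beyond `u` escape. From `|y| ≤ u - 2` the
next value is below `-u`, except for `u = 2`, `y = 0`. The borderline values `u - 1` and `u` survive
two steps only when they feed back into each other. -/
theorem escapes_or_abs_eq {m u y : ℤ} (hm2 : 2 ≤ m) (hsq : ¬ IsSquare m) (hu : 2 ≤ u)
    (hlo : u ^ 2 - u ≤ m) (hhi : m < u ^ 2 + u) :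
    (∃ j ≤ 2, Escapes (-m) ((quadMap (-m))^[j] y)) ∨ (m = 2 ∧ y = 0) ∨
      ((m = u ^ 2 - u ∨ m = u ^ 2 - u + 1) ∧ (|y| = u ∨ |y| = u - 1)) := by
  have esc : ∀ j ≤ 2, u < |(quadMap (-m))^[j] y| →
      ∃ j ≤ 2, Escapes (-m) ((quadMap (-m))^[j] y) :=
    fun j hj h => ⟨j, hj, escapes_of_lt_abs hu hhi h⟩
  have h1 : ∀ {t : ℤ}, |y| = t → (quadMap (-m))^[1] y = t ^ 2 - m := quadMap_eq_of_abs_eq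
  have h2 : ∀ {t : ℤ}, |(quadMap (-m))^[1] y| = t → (quadMap (-m))^[2] y = t ^ 2 - m :=
    quadMap_eq_of_abs_eq
  have hy0 := abs_nonneg y
  by_contra! H
  obtain ⟨H1, H2, H3⟩ := H
  have E : ∀ j ≤ 2, |(quadMap (-m))^[j] y| ≤ u := fun j hj => by
    by_contra! h
    obtain ⟨i, hi, he⟩ := esc j hj h
    exact H1 i hi he
  have e0 : |y| ≤ u := E 0 (by norm_num)
  have e1 := E 1 (by norm_num)
  have e2 := E 2 (by norm_num)
  rcases (by omega : |y| ≤ u - 2 ∨ |y| = u - 1 ∨ |y| = u) with h | h | h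
  · rw [h1 rfl, abs_le] at e1
    have hu2 : u = 2 := by nlinarith
    subst hu2
    have hy : |y| = 0 := by omega
    rw [hy] at e1
    exact H2 (by omega) (abs_eq_zero.1 hy)
  · rw [h1 h, abs_le] at e1
    have : m = u ^ 2 - u ∨ m = u ^ 2 - u + 1 := by
      have : u ^ 2 - u + 1 ≥ m := by linarith
      omega
    exact (H3 this).2 h
  · have hv := h1 h
    have hsmall : |(quadMap (-m))^[1] y| ≤ u - 2 → False := fun hs => by
      have hn := abs_nonneg ((quadMap (-m))^[1] y)
      rw [h2 rfl, abs_le] at e2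
      have hu2 : u = 2 := by nlinarith
      subst hu2
      have h0 : |(quadMap (-m))^[1] y| = 0 := by omega
      rw [abs_eq_zero, hv] at h0
      exact hsq ⟨2, by linarith⟩
    have hm' : m ≠ u ^ 2 - u := fun h' => (H3 (Or.inl h')).1 h
    have hm'' : m ≠ u ^ 2 - u + 1 := fun h' => (H3 (Or.inr h')).1 h
    rw [hv, abs_le] at hsmall
    by_cases hm3 : m = u ^ 2 + u - 1
    · have : |(quadMap (-m))^[1] y| = u - 1 := by
        rw [hv, hm3, abs_of_nonpos] <;> linarith
      rw [h2 this, abs_le] at e2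
      nlinarith
    · exact hsmall ⟨by omega, by omega⟩

/-- The parameters `c` for which `x² + c` has the nonzero square `s²` as a fixed point or as a point
of exact period two. -/
def SquarePeriodic (c s : ℤ) : Prop :=
  1 ≤ s ∧ (c = s ^ 2 - s ^ 4 ∨ c = -(s ^ 4 + s ^ 2 + 1))

theorem iterate_quadMap_even {c y z : ℤ} (h1 : (quadMap c)^[2] y = z) (h2 : (quadMap c)^[2] z = z)
    (k : ℕ) : (quadMap c)^[2 * (k + 1)] y = z := by
  rw [Function.iterate_mul, Function.iterate_succ_apply, h1]
  exact Function.iterate_fixed h2 k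

theorem exists_pos_sq_of_isSquare {z : ℤ} (hz : 0 < z) (h : IsSquare z) : ∃ s, 1 ≤ s ∧ z = s ^ 2 := by
  obtain ⟨r, rfl⟩ := h
  refine ⟨|r|, ?_, by rw [sq_abs, sq]⟩
  have : 0 < |r| := abs_pos.2 (by rintro rfl; simp at hz)
  omega

theorem exists_squarePeriodic_of_isSquare_iterate {c : ℤ} (hc : ¬ IsSquare (-c)) {y : ℤ} {k : ℕ}
    -- Escape starts by step 2, then `|c|` steps of growth and one more suffice. Evenness fixes
    -- which point of a 2-cycle is reached.
    (hk : c.natAbs + 3 ≤ 2 * (k + 1)) (h : IsSquare ((quadMap c)^[2 * (k + 1)] y)) :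
    ∃ s, SquarePeriodic c s ∧ y ^ 2 = s ^ 4 := by
  have h0 : c ≠ 0 := by rintro rfl; simp at hc
  have h1 : c ≠ -1 := by rintro rfl; simp at hc
  have hne : ∀ j ≤ 2, ¬ Escapes c ((quadMap c)^[j] y) := fun j hj he =>
    he.not_isSquare_iterate h0 h1 (by omega) h
  rcases lt_or_gt_of_ne h0 with hneg | hpos
  swap
  · exact absurd (escapes_of_pos hpos y) (hne 0 (by norm_num))
  obtain ⟨m, rfl⟩ : ∃ m, c = -m := ⟨-c, by ring⟩
  rw [neg_neg] at hc
  have hm : 2 ≤ m := by omega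
  obtain ⟨u, hu, hlo, hhi⟩ := exists_sq_sub_self_le_lt hm
  rcases escapes_or_abs_eq (y := y) hm hc hu hlo hhi with ⟨j, hj, he⟩ | ⟨rfl, rfl⟩ | ⟨rfl | rfl, hy⟩
  · exact absurd he (hne j hj)
  · rw [iterate_quadMap_even (z := 2) (by simp [quadMap]) (by simp [quadMap])] at h
    exact absurd h hc
  · rcases hy with hy | hy
    · have e : (quadMap (-(u ^ 2 - u)))^[2] y = u := by
        simp only [Function.iterate_succ, Function.iterate_zero, Function.comp_apply, id]
        rw [quadMap_eq_of_abs_eq hy, quadMap]; ring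
      have e' : (quadMap (-(u ^ 2 - u)))^[2] u = u := by
        simp only [Function.iterate_succ, Function.iterate_zero, Function.comp_apply, id, quadMap]
        ring
      rw [iterate_quadMap_even e e'] at h
      obtain ⟨s, hs, rfl⟩ := exists_pos_sq_of_isSquare (by omega) h
      exact ⟨s, ⟨hs, Or.inl (by ring)⟩, by rw [← sq_abs, hy]; ring⟩
    · have e : (quadMap (-(u ^ 2 - u)))^[2] y = 1 - u := by
        simp only [Function.iterate_succ, Function.iterate_zero, Function.comp_apply, id]
        rw [quadMap_eq_of_abs_eq hy, quadMap]; ring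
      have e' : (quadMap (-(u ^ 2 - u)))^[2] (1 - u) = 1 - u := by
        simp only [Function.iterate_succ, Function.iterate_zero, Function.comp_apply, id, quadMap]
        ring
      rw [iterate_quadMap_even e e'] at h
      have := h.nonneg
      omega
  · rcases hy with hy | hy
    · have e : (quadMap (-(u ^ 2 - u + 1)))^[2] y = -u := by
        simp only [Function.iterate_succ, Function.iterate_zero, Function.comp_apply, id]
        rw [quadMap_eq_of_abs_eq hy, quadMap]; ring
      have e' : (quadMap (-(u ^ 2 - u + 1)))^[2] (-u) = -u := by
        simp only [Function.iterate_succ, Function.iterate_zero, Function.comp_apply, id, quadMap]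
        ring
      rw [iterate_quadMap_even e e'] at h
      have := h.nonneg
      omega
    · have e : (quadMap (-(u ^ 2 - u + 1)))^[2] y = u - 1 := by
        simp only [Function.iterate_succ, Function.iterate_zero, Function.comp_apply, id]
        rw [quadMap_eq_of_abs_eq hy, quadMap]; ring
      have e' : (quadMap (-(u ^ 2 - u + 1)))^[2] (u - 1) = u - 1 := by
        simp only [Function.iterate_succ, Function.iterate_zero, Function.comp_apply, id, quadMap]
        ring
      rw [iterate_quadMap_even e e'] at h
      obtain ⟨s, hs, hus⟩ := exists_pos_sq_of_isSquare (by omega) h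
      obtain rfl : u = s ^ 2 + 1 := by omega
      exact ⟨s, ⟨hs, Or.inr (by ring)⟩, by rw [← sq_abs, hy]; ring⟩

/-! ### Avoiding the periodic squares -/

/-- An integer of the form `a² + c`, where `c` is exceptional for `s`, is large in absolute value. -/
theorem le_abs_quadMap_of_squarePeriodic {c s : ℤ} (h : SquarePeriodic c s) (a : ℤ) :
    s ^ 2 - 1 ≤ |quadMap c a| := by
  obtain ⟨hs, hc⟩ := h
  by_contra! H
  rw [abs_lt] at H
  rw [quadMap, ← sq_abs a] at H
  have ha := abs_nonneg a
  generalize |a| = t at *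
  rcases hc with rfl | rfl
  · have h1 : t < s ^ 2 := by nlinarith
    have h2 : s ^ 2 - 1 < t := by nlinarith
    omega
  · have h1 : t < s ^ 2 + 1 := by nlinarith
    have h2 : s ^ 2 < t := by nlinarith
    omega

theorem quadMap_comp_ne_of_lt {c d s t : ℤ} (hc : SquarePeriodic c s) (hd : SquarePeriodic d t)
    (hts : t < s) (a : ℤ) : quadMap d (quadMap c a) ^ 2 ≠ s ^ 4 := by
  intro h
  have hb := le_abs_quadMap_of_squarePeriodic hc a
  generalize quadMap c a = b at *
  obtain ⟨ht, hd⟩ := hd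
  have hle : quadMap d b ≤ s ^ 2 := abs_le_of_sq_le_sq' (by linarith) (by positivity) |>.2
  have hd' : -d ≤ t ^ 4 + t ^ 2 + 1 := by rcases hd with rfl | rfl <;> nlinarith
  rw [quadMap, ← sq_abs b] at hle
  have hbb : (s ^ 2 - 1) ^ 2 ≤ |b| ^ 2 := pow_le_pow_left₀ (by nlinarith) hb 2
  have ht2 : t ^ 2 ≤ (s - 1) ^ 2 := pow_le_pow_left₀ (by linarith) (by linarith) 2
  have ht4 : t ^ 4 ≤ (s - 1) ^ 4 := pow_le_pow_left₀ (by linarith) (by linarith) 4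
  obtain ⟨r, rfl⟩ : ∃ r, s = r + 2 := ⟨s - 2, by ring⟩
  have hr : 0 ≤ r := by omega
  nlinarith [pow_nonneg hr 2, pow_nonneg hr 3]

theorem sq_ne_sq_add {n k a : ℤ} (hn : 0 ≤ n) (hk : 0 < k) (hk' : k ≤ 2 * n) : a ^ 2 ≠ n ^ 2 + k := by
  intro h
  rw [← sq_abs a] at h
  have h1 : n < |a| := by nlinarith [abs_nonneg a]
  have h2 : |a| < n + 1 := by nlinarith [abs_nonneg a]
  omega

/-- Pulling `±s²` back twice would require a square strictly between consecutive squares, or a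
negative one. The order matters: the opposite composition does hit `s²`, at `a = s² + 1`. -/
theorem quadMap_comp_ne_of_eq {s : ℤ} (hs : 1 ≤ s) (a : ℤ) :
    quadMap (-(s ^ 4 + s ^ 2 + 1)) (quadMap (s ^ 2 - s ^ 4) a) ^ 2 ≠ s ^ 4 := by
  intro h
  have hs2 : 1 ≤ s ^ 2 := by nlinarith
  rw [show s ^ 4 = (s ^ 2) ^ 2 by ring, sq_eq_sq_iff_eq_or_eq_neg] at h
  rcases h with h | h
  · have hb : quadMap ((s ^ 2) - (s ^ 2) ^ 2) a ^ 2 = (s ^ 2 + 1) ^ 2 := by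
      rw [quadMap] at h; linear_combination h
    rw [sq_eq_sq_iff_eq_or_eq_neg] at hb
    rcases hb with hb | hb
    · exact sq_ne_sq_add (n := s ^ 2) (k := 1) (a := a) (by omega) (by omega) (by omega)
        (by rw [quadMap] at hb; linear_combination hb)
    · have ha : a ^ 2 = (s ^ 2 - 1) ^ 2 - 2 := by rw [quadMap] at hb; linear_combination hb
      rcases (by omega : s ^ 2 = 1 ∨ s ^ 2 = 2 ∨ 3 ≤ s ^ 2) with h1 | h1 | h1
      · rw [h1] at ha; nlinarith [sq_nonneg a]
      · rw [h1] at ha; nlinarith [sq_nonneg a]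
      · exact sq_ne_sq_add (n := s ^ 2 - 2) (k := 2 * s ^ 2 - 5) (a := a) (by omega) (by omega)
          (by omega) (by linear_combination ha)
  · refine sq_ne_sq_add (n := s ^ 2) (k := 1) (a := quadMap ((s ^ 2) - (s ^ 2) ^ 2) a) (by omega)
      (by omega) (by omega) ?_
    rw [quadMap] at h; linear_combination h

theorem quadMap_comp_ne_of_ne {c d : ℤ} (hcd : c ≠ d) :
    (∀ s a, SquarePeriodic c s → quadMap d (quadMap c a) ^ 2 ≠ s ^ 4) ∨
      (∀ s a, SquarePeriodic d s → quadMap c (quadMap d a) ^ 2 ≠ s ^ 4) := by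
  by_contra! ⟨⟨s, a, hs, ha⟩, ⟨t, b, ht, hb⟩⟩
  rcases lt_trichotomy t s with h | rfl | h
  · exact quadMap_comp_ne_of_lt hs ht h a ha
  · obtain ⟨ht1, rfl | rfl⟩ := ht <;> obtain ⟨-, rfl | rfl⟩ := hs
    · exact hcd rfl
    · exact quadMap_comp_ne_of_eq ht1 b hb
    · exact quadMap_comp_ne_of_eq ht1 a ha
    · exact hcd rfl
  · exact quadMap_comp_ne_of_lt ht hs h b hb

theorem quadMap_zero_sq_ne {d s : ℤ} (hd : ¬ IsSquare (-d)) (hd0 : d ≤ 0) : 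
    quadMap d 0 ^ 2 ≠ s ^ 4 := by
  intro h
  rw [show s ^ 4 = (s ^ 2) ^ 2 by ring, sq_eq_sq_iff_eq_or_eq_neg, quadMap] at h
  rcases h with h | h
  · have : d = 0 := by nlinarith [sq_nonneg s]
    simp [this] at hd
  · exact hd ⟨s, by linear_combination -h⟩

theorem SquarePeriodic.nonpos {c s : ℤ} (h : SquarePeriodic c s) : c ≤ 0 := by
  obtain ⟨hs, rfl | rfl⟩ := h
  · nlinarith [mul_nonneg (sq_nonneg s) (by nlinarith : 0 ≤ s ^ 2 - 1)]
  · nlinarith [sq_nonneg s, sq_nonneg (s ^ 2)]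

/-- Every value of `x² + d` at `0` or at a value of `x² + c` has orbit under `x² + c` avoiding the
periodic squares. -/
def AvoidsSquares (c d : ℤ) : Prop :=
  ∀ s, SquarePeriodic c s → quadMap d 0 ^ 2 ≠ s ^ 4 ∧ ∀ a, quadMap d (quadMap c a) ^ 2 ≠ s ^ 4

theorem avoidsSquares_or {c d : ℤ} (hc : ¬ IsSquare (-c)) (hd : ¬ IsSquare (-d)) (hcd : c ≠ d) :
    AvoidsSquares c d ∨ AvoidsSquares d c := by
  by_cases hc0 : c ≤ 0
  swap
  · exact Or.inl fun s hs => absurd hs.nonpos hc0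
  by_cases hd0 : d ≤ 0
  swap
  · exact Or.inr fun s hs => absurd hs.nonpos hd0
  exact (quadMap_comp_ne_of_ne hcd).imp
    (fun h s hs => ⟨quadMap_zero_sq_ne hd hd0, fun a => h s a hs⟩)
    (fun h s hs => ⟨quadMap_zero_sq_ne hc hc0, fun a => h s a hs⟩)

/-! ### Irreducibility of the compositions -/

/-- The polynomial `x² + c`. -/
noncomputable def quadPoly (c : ℤ) : ℚ[X] := X ^ 2 + C (c : ℚ)

theorem not_isSquare_neg_of_irreducible {c : ℤ} (h : Irreducible (quadPoly c)) :
    ¬ IsSquare (-c) := by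
  rintro ⟨r, hr⟩
  have h' : Irreducible (X ^ 2 - C ((-c : ℤ) : ℚ)) := by
    simpa [quadPoly] using h
  refine (X_pow_sub_C_irreducible_iff_of_prime Nat.prime_two).1 h' r ?_
  rw [hr]; push_cast; ring

theorem eval_quadPoly (c a : ℤ) : (quadPoly c).eval (a : ℚ) = (quadMap c a : ℤ) := by
  simp [quadPoly, quadMap]

theorem monic_quadPoly (c : ℤ) : (quadPoly c).Monic := monic_X_pow_add_C _ two_ne_zero

theorem natDegree_quadPoly (c : ℤ) : (quadPoly c).natDegree = 2 := natDegree_X_pow_add_C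

theorem polyIterate_succ (φ : ℚ[X]) (n : ℕ) :
    polyIterate φ (n + 1) = (polyIterate φ n).comp φ := by
  have h : ∀ q : ℚ[X], φ.comp^[n] q = (polyIterate φ n).comp q := by
    unfold polyIterate
    induction n with
    | zero => simp
    | succ n ih =>
      intro q
      rw [Function.iterate_succ_apply', Function.iterate_succ_apply', ih, comp_assoc]
  rw [polyIterate, Function.iterate_succ_apply, h, comp_X]

theorem eval_polyIterate_quadPoly (c : ℤ) (n : ℕ) (a : ℤ) :
    (polyIterate (quadPoly c) n).eval (a : ℚ) = ((quadMap c)^[n] a : ℤ) := by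
  induction n generalizing a with
  | zero => simp [polyIterate]
  | succ n ih => rw [polyIterate_succ, eval_comp, eval_quadPoly, ih, Function.iterate_succ_apply]

/-- Monic irreducible polynomials of even degree. -/
structure MonicIrreducibleEven (f : ℚ[X]) : Prop where
  monic : f.Monic
  irreducible : Irreducible f
  even : Even f.natDegree

theorem MonicIrreducibleEven.comp_quadPoly {f : ℚ[X]} (hf : MonicIrreducibleEven f) {c n : ℤ}
    (hn : f.eval (c : ℚ) = n) (h : ¬ IsSquare n) : MonicIrreducibleEven (f.comp (quadPoly c)) where
  monic := hf.monic.comp (monic_quadPoly c) (by simp [natDegree_quadPoly])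
  irreducible := irreducible_comp_X_sq_add_C hf.monic hf.irreducible hf.even
    (by rwa [hn, Rat.isSquare_intCast_iff])
  even := by rw [natDegree_comp, natDegree_quadPoly]; exact even_two.mul_left _

theorem monicIrreducibleEven_polyIterate {c : ℤ} (h : Irreducible (quadPoly c)) (n : ℕ) :
    MonicIrreducibleEven (polyIterate (quadPoly c) (n + 1)) := by
  have hc := not_isSquare_neg_of_irreducible h
  have h0 : c ≠ 0 := by rintro rfl; simp at hc
  have h1 : c ≠ -1 := by rintro rfl; simp at hc
  induction n with
  | zero =>
    have : polyIterate (quadPoly c) (0 + 1) = quadPoly c := by simp [polyIterate]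
    rw [this]
    exact ⟨monic_quadPoly c, h, by rw [natDegree_quadPoly]; exact even_two⟩
  | succ n ih =>
    rw [polyIterate_succ]
    refine ih.comp_quadPoly (eval_polyIterate_quadPoly c (n + 1) c) ?_
    have := not_isSquare_iterate_quadMap_zero h0 h1 n
    rwa [Function.iterate_succ_apply, show quadMap c 0 = c by simp [quadMap]] at this

theorem MonicIrreducibleEven.comp_foldr {S : Set ℚ[X]} (hS : ∀ θ ∈ S, ∃ c : ℤ, θ = quadPoly c)
    {l : List ℚ[X]} (hl : ∀ θ ∈ l, θ ∈ S) {f : ℚ[X]} (hf : MonicIrreducibleEven f)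
    (h : ∀ a : ℤ, ∃ n : ℤ, f.eval (a : ℚ) = n ∧ ¬ IsSquare n) :
    MonicIrreducibleEven (f.comp (l.foldr Polynomial.comp X)) := by
  induction l generalizing f with
  | nil => simpa using hf
  | cons θ l ih =>
    obtain ⟨c, rfl⟩ := hS θ (hl θ List.mem_cons_self)
    obtain ⟨n, hn, hsq⟩ := h c
    rw [List.foldr_cons, ← comp_assoc]
    refine ih (fun θ hθ => hl θ (List.mem_cons_of_mem _ hθ)) (hf.comp_quadPoly hn hsq) fun a => ?_
    rw [eval_comp, eval_quadPoly]
    exact h _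

theorem irreducible_polyIterate_comp {S : Set ℚ[X]} (hS : ∀ θ ∈ S, ∃ c : ℤ, θ = quadPoly c)
    {c d : ℤ} (hc : Irreducible (quadPoly c)) (hcd : AvoidsSquares c d) {F : ℚ[X]}
    (hF : F ∈ compSemigroup S) :
    Irreducible ((polyIterate (quadPoly c) (2 * (c.natAbs + 2 + 1))).comp
      ((quadPoly d).comp ((quadPoly c).comp F))) := by
  obtain ⟨l, -, hl, rfl⟩ := hF
  have hsq := not_isSquare_neg_of_irreducible hc
  set N := 2 * (c.natAbs + 2 + 1) with hN
  have key : ∀ y : ℤ, (∀ s, SquarePeriodic c s → y ^ 2 ≠ s ^ 4) → ¬ IsSquare ((quadMap c)^[N] y) :=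
    fun y hy h => by
      obtain ⟨s, hs, he⟩ := exists_squarePeriodic_of_isSquare_iterate hsq (by omega) h
      exact hy s hs he
  have hP : MonicIrreducibleEven (polyIterate (quadPoly c) N) :=
    monicIrreducibleEven_polyIterate hc (2 * c.natAbs + 5)
  have h1 := hP.comp_quadPoly (eval_polyIterate_quadPoly c N d)
    (key d fun s hs => by simpa [quadMap] using (hcd s hs).1)
  have heval : ∀ a : ℤ, ((polyIterate (quadPoly c) N).comp (quadPoly d)).eval (a : ℚ) =
      ((quadMap c)^[N] (quadMap d a) : ℤ) := fun a => by
    rw [eval_comp, eval_quadPoly, eval_polyIterate_quadPoly]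
  -- Since `c = φ 0`, this is the case `a = 0`.
  have h2 := h1.comp_quadPoly (heval c)
    (key _ fun s hs => by simpa [quadMap] using (hcd s hs).2 0)
  rw [← comp_assoc, ← comp_assoc]
  refine (h2.comp_foldr hS hl fun a => ⟨_, ?_, key _ fun s hs => (hcd s hs).2 a⟩).irreducible
  rw [eval_comp, eval_quadPoly, heval]

theorem theorem1p1 {s : ℕ} (c : Fin s → ℤ) (hc : Function.Injective c)
    (hirr : {φ ∈ quadraticSet c | Irreducible φ}.Nontrivial) :
    ∃ N : ℕ, 2 ≤ N ∧ ∃ φ ∈ quadraticSet c, ∃ ψ ∈ quadraticSet c,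
      ∀ F ∈ compSemigroup (quadraticSet c),
        Irreducible ((polyIterate φ N).comp (ψ.comp (φ.comp F))) := by
  have hS : ∀ θ ∈ quadraticSet c, ∃ n : ℤ, θ = quadPoly n := by
    rintro _ ⟨i, rfl⟩
    exact ⟨c i, rfl⟩
  obtain ⟨φ, ⟨hφ, hφi⟩, ψ, ⟨hψ, hψi⟩, hne⟩ := hirr
  obtain ⟨m, rfl⟩ := hS φ hφ
  obtain ⟨n, rfl⟩ := hS ψ hψ
  have hmn : m ≠ n := fun h => hne (by rw [h])
  rcases avoidsSquares_or (not_isSquare_neg_of_irreducible hφi)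
    (not_isSquare_neg_of_irreducible hψi) hmn with h | h
  · exact ⟨_, by omega, _, hφ, _, hψ, fun F hF => irreducible_polyIterate_comp hS hφi h hF⟩
  · exact ⟨_, by omega, _, hψ, _, hφ, fun F hF => irreducible_polyIterate_comp hS hψi h hF⟩
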